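/- **Setting.** A state $s$ is a finite set of ground atoms. A classical domain $D_c$ is a set of actions $a$ (ground instances of operators), each with preconditions and effects (conjuncts of ground literals) and a cost $\mathrm{cost}(a)\ge 0$; the action $a$ is applicable in $s$ if $s\models\mathrm{precond}(a)$, and then $\gamma(s,a)=(s\setminus\mathrm{eff}^-(a))\cup\mathrm{eff}^+(a)$; the cost of a plan (a sequence of actions) is the sum of the costs of its actions. A goal network $gn=(T,\prec)$ is a finite, partially ordered set of nodes $t$, each with a goal $g_t$ (a DNF formula over ground literals); a node without predecessors is unconstrained. A method $m$ has a goal (a conjunct), preconditions (a conjunct) and a goal network whose last (greatest) node $t_g$ contains its goal. An action (a method) is relevant to a goal $g$ if a literal that occurs in $g$ is among its effects (in its goal). For an unconstrained $t$, $gn-t$ is $gn$ without $t$, and $gn\circ_t m$ adds a disjoint copy of the network of $m$ to $gn$ and orders $t_g$ before $t$. An HGN domain is $D=(D_c,M)$ with a set $M$ of methods. The solutions of $(D,s,gn)$ are defined inductively: the empty plan, if $T=\emptyset$; and, for an unconstrained $t\in T$: every solution of $(D,s,gn-t)$ if $s\models g_t$; $a\circ\pi$ if $a$ is applicable in $s$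 and relevant to $g_t$ and $\pi$ solves $(D,\gamma(s,a),gn)$; every solution of $(D,s,gn\circ_t m)$ if $m\in M$ is applicable in $s$ and relevant to $g_t$. A solution is hierarchically optimal if no solution has a smaller cost. **Landmarks.** Let $\mathrm{LMGEN}$ be a sound landmark generator for classical planning in $D_c$: from a state $s$ and a goal $\psi$ it computes a finite list of formulas $\phi$, each of which is true at some point along every plan that is executable in $s$ and leads to a state that satisfies $\psi$. The procedure $\mathrm{computeHGNLandmarks}(s,gn)$ builds a graph $LG=(L,\mathrm{Ord})$ of landmarks and orderings: it treats the goals of $gn$ one by one, always one without successors among those left, and for each of them adds $g_t$ to $L$, together with its orderings to goals that are already in $L$, and to a queue; while the queue is not empty, it pops a formula $\psi$ and adds each $\phi\in\mathrm{LMGEN}(s,\psi)$ to $L$ with a greedy-necessary ordering to $\psi$. To add $\phi$ means: if $\phi$ is a single atom that entails another member of $L$, such members are removed with their orderings; then, if some member of $L$ entails $\phi$, this member takes the place of $\phi$; otherwise $\phi$ is put into $L$ and into the queue. **Heuristic.** Let $s_0$ be the initial state and let $(s,gn,\pi)$ be a search node: $\pi$ is executable in $s_0$ and leads to $s$. A landmark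 in $L$ is accepted if it was true at some point along $\pi$; an accepted landmark is required again if it is false in $s$ and greedy-necessarily ordered before a landmark that is not accepted. $\mathrm{Unreached}=L\setminus(\mathrm{Accepted}\setminus\mathrm{ReqAgain})$. Let $\mathrm{ach}(\phi)$ be the set of the actions that make $\phi$ change from false to true in some executable continuation from $s$. A cost partition consists of numbers $\mathrm{cost}(\phi)$ and $\mathrm{cost}(a,\phi)$ with $\mathrm{cost}(a,\phi)\ge 0$ and $\mathrm{cost}(\phi)\le\mathrm{cost}(a,\phi)$ for all $\phi\in\mathrm{Unreached}$ and $a\in\mathrm{ach}(\phi)$, and with $\sum_{\phi\in\mathrm{Unreached},\,a\in\mathrm{ach}(\phi)}\mathrm{cost}(a,\phi)\le\mathrm{cost}(a)$ for every action $a$. For such a partition, $h_{HL}(s,gn,\pi)=h_L(\mathrm{computeHGNLandmarks}(s,gn),s,\pi)=\sum_{\phi\in\mathrm{Unreached}}\mathrm{cost}(\phi)$. **Theorem 2.** Let $D=(D_c,M)$ be an HGN domain and $\mathrm{LMGEN}$ a sound landmark generator for $D_c$. (1) For every search node $(s,gn,\pi)$, every landmark graph that $\mathrm{computeHGNLandmarks}(s,gn)$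 can return, and every cost partition, $h_{HL}(s,gn,\pi)\le\mathrm{cost}(\rho)$ for every solution $\rho$ of $(D,s,gn)$, in particular for a cost-optimal one. (2) Consider, for an initial state $s_0$ and a goal network $gn_0$, the A* search HOpGDP with $f(s,gn,\pi)=\mathrm{cost}(\pi)+h_{HL}(s,gn,\pi)$: its queue initially contains $(s_0,gn_0,\langle\rangle)$; it repeatedly removes a node $(s,gn,\pi)$ of lowest $f$-value, returns $\pi$ if $gn$ is empty, and otherwise generates the successors $(s,gn-t,\pi)$ for unconstrained $t$ with $s\models g_t$, $(\gamma(s,a),gn,\pi\circ a)$ for actions $a$ applicable in $s$ and relevant to an unconstrained goal, and $(s,gn\circ_t m,\pi)$ for $m\in M$ applicable in $s$ and relevant to the goal of an unconstrained $t$; a successor is put into the queue if its pair (state, goal network) is new or its plan is cheaper than the best plan known for this pair; if the queue is empty, it returns failure. Every plan that HOpGDP returns is a hierarchically optimal solution of $(D,s_0,gn_0)$, and if HOpGDP returns failure, then $(D,s_0,gn_0)$ has no solution. -/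

import Mathlib

namespace HGN

/-! ### Classical planning -/

/-- A ground literal over a set `α` of ground atoms. -/
inductive Literal (α : Type*) where
  | pos (p : α) : Literal α
  | neg (p : α) : Literal α

/-- A state is a finite set of ground atoms. -/
abbrev State (α : Type*) := Finset α

/-- A conjunct (finite conjunction) of ground literals. -/
abbrev Conjunct (α : Type*) := Finset (Literal α)

/-- A formula in disjunctive normal form over ground literals. -/
abbrev Formula (α : Type*) := Finset (Conjunct α)

/-- Truth of a literal in a state (closed world). -/
def Literal.Holds {α : Type*} (s : State α) : Literal α → Prop
  | .pos p => p ∈ s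
  | .neg p => p ∉ s

/-- `s ⊨ c` for a conjunct of literals. -/
def Conjunct.Holds {α : Type*} (s : State α) (c : Conjunct α) : Prop :=
  ∀ l ∈ c, Literal.Holds s l

/-- `s ⊨ φ` for a DNF formula. -/
def Formula.Holds {α : Type*} (s : State α) (φ : Formula α) : Prop :=
  ∃ c ∈ φ, Conjunct.Holds s c

/-- `φ ⊨ φ'`. -/
def Formula.Entails {α : Type*} (φ φ' : Formula α) : Prop :=
  ∀ s : State α, φ.Holds s → φ'.Holds s

/-- A fact is a formula that consists of a single ground atom. -/
def Formula.IsFact {α : Type*} (φ : Formula α) : Prop :=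
  ∃ p : α, φ = {{Literal.pos p}}

/-- The atoms that occur positively in a conjunct. -/
noncomputable def Conjunct.posAtoms {α : Type*} (c : Conjunct α) : Finset α :=
  open scoped Classical in c.biUnion fun l => match l with
    | .pos p => {p}
    | .neg _ => ∅

/-- The atoms that occur negated in a conjunct. -/
noncomputable def Conjunct.negAtoms {α : Type*} (c : Conjunct α) : Finset α :=
  open scoped Classical in c.biUnion fun l => match l with
    | .pos _ => ∅
    | .neg p => {p}

/-- A classical planning domain. `α` is the set of ground atoms and `A` the set of actions, that is,
of (heads of) ground instances of the planning operators. -/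
structure ClassicalDomain (α A : Type*) where
  precond : A → Conjunct α
  effects : A → Conjunct α
  cost : A → ℝ
  cost_nonneg : ∀ a, 0 ≤ cost a

namespace ClassicalDomain

variable {α A : Type*} (D : ClassicalDomain α A)

/-- `a` is executable (applicable) in `s`. -/
def Applicable (s : State α) (a : A) : Prop := (D.precond a).Holds s

/-- `γ(s, a) = (s - effects⁻(a)) ∪ effects⁺(a)`. -/
noncomputable def result (s : State α) (a : A) : State α :=
  open scoped Classical in (s \ (D.effects a).negAtoms) ∪ (D.effects a).posAtoms

/-- The plan `π` is executable in `s`. -/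
def Executable : State α → List A → Prop
  | _, [] => True
  | s, a :: π => D.Applicable s a ∧ Executable (D.result s a) π

/-- `γ(s, π)`: the state produced by executing `π` in `s`. -/
noncomputable def run (s : State α) (π : List A) : State α := π.foldl D.result s

/-- The cost of a plan. -/
noncomputable def planCost (π : List A) : ℝ := (π.map D.cost).sum

/-- `φ` is true at some point along the execution of `π` from `s` (both ends included). -/
def TrueAlong (s : State α) (π : List A) (φ : Formula α) : Prop :=
  ∃ ρ : List A, ρ <+: π ∧ φ.Holds (D.run s ρ)

/-- `φ` is a landmark of the classical planning problem `(D, s, ψ)`: it is true at some point along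
every plan that is executable in `s` and ends in a state that satisfies the goal `ψ`. -/
def IsLandmark (s : State α) (ψ φ : Formula α) : Prop :=
  ∀ π : List A, D.Executable s π → ψ.Holds (D.run s π) → D.TrueAlong s π φ

/-- A classical landmark generation procedure maps an initial state `s` and a goal `ψ` to finitely
many formulas; it is sound if all of these are landmarks of the problem `(D, s, ψ)`. -/
def SoundGenerator (gen : State α → Formula α → List (Formula α)) : Prop :=
  ∀ s ψ φ, φ ∈ gen s ψ → D.IsLandmark s ψ φ

/-- `a` is relevant to the goal `g`: one of its effects is a literal of `g`. -/
def Relevant (a : A) (g : Formula α) : Prop := ∃ c ∈ g, ∃ l ∈ c, l ∈ D.effects a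

end ClassicalDomain

/-! ### Goal networks and methods -/

/-- A node of a goal network: an identifier, and the goal `g_t` that the node contains.
(Identifiers allow the same goal to occur several times.) -/
structure Node (α : Type*) where
  id : ℕ
  goal : Formula α

/-- A goal network: a finite set of nodes with a (strict) partial order on it. It may be empty,
which is what remains when all goals have been released. -/
@[ext] structure GoalNetwork (α : Type*) where
  nodes : Finset (Node α)
  lt : Node α → Node α → Prop
  lt_mem : ∀ {x y}, lt x y → x ∈ nodes ∧ y ∈ nodes
  lt_irrefl : ∀ x, ¬ lt x x
  lt_trans : ∀ {x y z}, lt x y → lt y z → lt x z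

/-- A (ground instance of an) HGN method, with the last node of its goal network. -/
structure Method (α : Type*) where
  goal : Conjunct α
  precond : Conjunct α
  network : GoalNetwork α
  last : Node α
  last_mem : last ∈ network.nodes
  last_goal : last.goal = {goal}
  lt_last : ∀ x ∈ network.nodes, x ≠ last → network.lt x last

/-- `m` is applicable in `s`. -/
def Method.Applicable {α : Type*} (s : State α) (m : Method α) : Prop := m.precond.Holds s

/-- `m` is relevant to the goal `g`: its own goal has a literal of `g`. -/
def Method.Relevant {α : Type*} (m : Method α) (g : Formula α) : Prop :=
  ∃ c ∈ g, ∃ l ∈ c, l ∈ m.goal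

/-- The node with the same goal and with the identifier increased by `k`. -/
def Node.shift {α : Type*} (k : ℕ) (x : Node α) : Node α := ⟨x.id + k, x.goal⟩

theorem Node.shift_injective {α : Type*} (k : ℕ) :
    Function.Injective (Node.shift k : Node α → Node α) := by
  rintro ⟨i, g⟩ ⟨j, h⟩ e
  simp only [Node.shift, Node.mk.injEq, Nat.add_right_cancel_iff] at e
  obtain ⟨rfl, rfl⟩ := e
  rfl

namespace GoalNetwork

variable {α : Type*}

/-- `t` is a node of `gn` without predecessors. -/
def Unconstrained (gn : GoalNetwork α) (t : Node α) : Prop :=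
  t ∈ gn.nodes ∧ ∀ u, ¬ gn.lt u t

/-- An upper bound (strict) for the identifiers used in `gn`. -/
def fresh (gn : GoalNetwork α) : ℕ := gn.nodes.sup fun x => x.id + 1

/-- A copy of a goal network with all identifiers increased by `k`. -/
noncomputable def shift (k : ℕ) (gn : GoalNetwork α) : GoalNetwork α where
  nodes := gn.nodes.map ⟨Node.shift k, Node.shift_injective k⟩
  lt x y := ∃ x' y', gn.lt x' y' ∧ x'.shift k = x ∧ y'.shift k = y
  lt_mem := by
    rintro _ _ ⟨x, y, h, rfl, rfl⟩
    exact ⟨Finset.mem_map_of_mem _ (gn.lt_mem h).1, Finset.mem_map_of_mem _ (gn.lt_mem h).2⟩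
  lt_irrefl := by
    rintro _ ⟨x, y, h, rfl, e⟩
    rw [Node.shift_injective k e] at h
    exact gn.lt_irrefl _ h
  lt_trans := by
    rintro _ _ _ ⟨x, y, h, rfl, rfl⟩ ⟨y', z, h', e, rfl⟩
    rw [Node.shift_injective k e] at h'
    exact ⟨x, z, gn.lt_trans h h', rfl, rfl⟩

theorem id_lt_fresh {gn : GoalNetwork α} {x : Node α} (h : x ∈ gn.nodes) : x.id < gn.fresh :=
  Finset.le_sup (f := fun x : Node α => x.id + 1) h

theorem not_mem_shift {gn gm : GoalNetwork α} {x : Node α} (h : x ∈ gn.nodes) :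
    x ∉ (gm.shift gn.fresh).nodes := by
  intro h'
  obtain ⟨y, -, rfl⟩ := Finset.mem_map.1 h'
  have := id_lt_fresh h
  simp [Node.shift] at this

/-- Goal release: `gn - t`. -/
noncomputable def release (gn : GoalNetwork α) (t : Node α) : GoalNetwork α where
  nodes := open scoped Classical in gn.nodes.erase t
  lt x y := gn.lt x y ∧ x ≠ t ∧ y ≠ t
  lt_mem := by
    intro x y h
    simp only [Finset.mem_erase]
    exact ⟨⟨h.2.1, (gn.lt_mem h.1).1⟩, h.2.2, (gn.lt_mem h.1).2⟩
  lt_irrefl := fun x h => gn.lt_irrefl x h.1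
  lt_trans := fun h h' => ⟨gn.lt_trans h.1 h'.1, h.2.1, h'.2.2⟩

/-- The generating relation `≺ ∪ ≺_m ∪ {(t_g, t)}` of the network `gn ∘_t m`, where the network of
`m` has been replaced by a copy that is disjoint from `gn`. -/
inductive ApplyRel (gn : GoalNetwork α) (t : Node α) (m : Method α) : Node α → Node α → Prop
  | old {x y} : gn.lt x y → ApplyRel gn t m x y
  | new {x y} : (m.network.shift gn.fresh).lt x y → ApplyRel gn t m x y
  | link : ApplyRel gn t m (m.last.shift gn.fresh) t

theorem ApplyRel.transGen_cases {gn : GoalNetwork α} {t : Node α} (ht : t ∈ gn.nodes)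
    {m : Method α} {x y : Node α} (h : Relation.TransGen (ApplyRel gn t m) x y) :
    gn.lt x y ∨ (m.network.shift gn.fresh).lt x y ∨
      (x ∈ (m.network.shift gn.fresh).nodes ∧ y ∈ gn.nodes) := by
  have base : ∀ {x y}, ApplyRel gn t m x y → gn.lt x y ∨ (m.network.shift gn.fresh).lt x y ∨
      (x ∈ (m.network.shift gn.fresh).nodes ∧ y ∈ gn.nodes) := by
    rintro x y (h | h | _)
    · exact .inl h
    · exact .inr (.inl h)
    · exact .inr (.inr ⟨Finset.mem_map_of_mem _ m.last_mem, ht⟩)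
  induction h with
  | single h => exact base h
  | tail _ h ih =>
    rcases ih with h1 | h1 | h1 <;> rcases base h with h2 | h2 | h2
    · exact .inl (gn.lt_trans h1 h2)
    · exact absurd (lt_mem _ h2).1 (not_mem_shift (gn.lt_mem h1).2)
    · exact absurd h2.1 (not_mem_shift (gn.lt_mem h1).2)
    · exact absurd (lt_mem _ h1).2 (not_mem_shift (gn.lt_mem h2).1)
    · exact .inr (.inl (lt_trans _ h1 h2))
    · exact .inr (.inr ⟨(lt_mem _ h1).1, h2.2⟩)
    · exact .inr (.inr ⟨h1.1, (gn.lt_mem h2).2⟩)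
    · exact absurd (lt_mem _ h2).1 (not_mem_shift h1.2)
    · exact absurd h2.1 (not_mem_shift h1.2)

/-- Method application: `gn ∘_t m`. The order is the partial order generated by
`≺ ∪ ≺_m ∪ {(t_g, t)}`. -/
noncomputable def apply (gn : GoalNetwork α) (t : Node α) (ht : t ∈ gn.nodes) (m : Method α) :
    GoalNetwork α where
  nodes := open scoped Classical in gn.nodes ∪ (m.network.shift gn.fresh).nodes
  lt := Relation.TransGen (ApplyRel gn t m)
  lt_mem := by
    intro x y h
    simp only [Finset.mem_union]
    rcases ApplyRel.transGen_cases ht h with h | h | h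
    · exact ⟨.inl (gn.lt_mem h).1, .inl (gn.lt_mem h).2⟩
    · exact ⟨.inr (lt_mem _ h).1, .inr (lt_mem _ h).2⟩
    · exact ⟨.inr h.1, .inl h.2⟩
  lt_irrefl := by
    intro x h
    rcases ApplyRel.transGen_cases ht h with h | h | h
    · exact lt_irrefl _ _ h
    · exact lt_irrefl _ _ h
    · exact not_mem_shift h.2 h.1
  lt_trans := fun h h' => h.trans h'

end GoalNetwork

/-! ### HGN domains and solutions -/

/-- An HGN domain: a classical planning domain and a family of methods, indexed by their heads. -/
structure HGNDomain (α A M : Type*) where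
  classical : ClassicalDomain α A
  method : M → Method α

namespace HGNDomain

variable {α A M : Type*} (D : HGNDomain α A M)

/-- `D.Solves s gn π`: the plan `π` is a solution of the HGN planning problem `(D, s, gn)`. -/
inductive Solves : State α → GoalNetwork α → List A → Prop
  | base {s gn} : gn.nodes = ∅ → Solves s gn []
  | goalSatisfaction {s gn t π} : gn.Unconstrained t → t.goal.Holds s →
      Solves s (gn.release t) π → Solves s gn π
  | action {s gn t a π} : gn.Unconstrained t → D.classical.Applicable s a →
      D.classical.Relevant a t.goal → Solves (D.classical.result s a) gn π → Solves s gn (a :: π)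
  | decomposition {s gn t π} (m : M) (ht : gn.Unconstrained t) : (D.method m).Applicable s →
      (D.method m).Relevant t.goal → Solves s (gn.apply t ht.1 (D.method m)) π → Solves s gn π

/-- `π` is a hierarchically optimal (cost-optimal) solution of `(D, s, gn)`. -/
def IsHierarchicallyOptimal (s : State α) (gn : GoalNetwork α) (π : List A) : Prop :=
  D.Solves s gn π ∧ ∀ ρ, D.Solves s gn ρ → D.classical.planCost π ≤ D.classical.planCost ρ

end HGNDomain

/-! ### Landmark graphs and their computation for goal networks -/

/-- The kinds of orderings between landmarks. -/
inductive OrderKind where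
  | natural
  | greedyNecessary

/-- A landmark graph: a finite set of landmarks, and orderings between them. -/
structure LandmarkGraph (α : Type*) where
  landmarks : Finset (Formula α)
  orderings : Set (Formula α × OrderKind × Formula α)

namespace LandmarkGraph

variable {α : Type*}

/-- The empty landmark graph. -/
def empty : LandmarkGraph α := ⟨∅, ∅⟩

/-- Remove the landmarks in `R`, and all orderings that one of them is part of. -/
noncomputable def remove (G : LandmarkGraph α) (R : Finset (Formula α)) : LandmarkGraph α where
  landmarks := open scoped Classical in G.landmarks \ R
  orderings := {o ∈ G.orderings | o.1 ∉ R ∧ o.2.2 ∉ R}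

/-- Add a landmark. -/
noncomputable def insert (G : LandmarkGraph α) (φ : Formula α) : LandmarkGraph α where
  landmarks := open scoped Classical in Insert.insert φ G.landmarks
  orderings := G.orderings

/-- Add orderings. -/
def addOrderings (G : LandmarkGraph α) (O : Set (Formula α × OrderKind × Formula α)) :
    LandmarkGraph α where
  landmarks := G.landmarks
  orderings := G.orderings ∪ O

/-- `φ` is a fact, and `φ'` is a landmark of `G` that is subsumed by, and different from, `φ`. -/
def Subsumed (G : LandmarkGraph α) (φ φ' : Formula α) : Prop :=
  φ.IsFact ∧ φ' ∈ G.landmarks ∧ φ' ≠ φ ∧ φ.Entails φ'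

/-- The first step of `addLM φ`: if there are landmarks that are subsumed by the fact `φ`, then
such landmarks (one of them, several of them or all of them) are removed. -/
def RemoveSubsumed (G : LandmarkGraph α) (φ : Formula α) (G' : LandmarkGraph α) : Prop :=
  ∃ R : Finset (Formula α), (∀ φ' ∈ R, G.Subsumed φ φ') ∧
    ((∃ φ', G.Subsumed φ φ') → R.Nonempty) ∧ G' = G.remove R

/-- `AddLM φ G q G' q' η`: the call `addLM(φ)` with landmark graph `G` and queue `q` can return `η`
and leave the landmark graph `G'` and the queue `q'`. -/
inductive AddLM (φ : Formula α) (G : LandmarkGraph α) (q : List (Formula α)) :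
    LandmarkGraph α → List (Formula α) → Formula α → Prop
  | subsumed {G' φ'} : G.RemoveSubsumed φ G' → φ' ∈ G'.landmarks → φ'.Entails φ →
      AddLM φ G q G' q φ'
  | new {G'} : G.RemoveSubsumed φ G' → (∀ φ' ∈ G'.landmarks, ¬ φ'.Entails φ) →
      AddLM φ G q (G'.insert φ) (q ++ [φ]) φ

/-- `AddAll ψ Φ G q G' q'`: the loop that, for each `φ` in the list `Φ`, calls `addLM(φ)` and adds a
greedy-necessary ordering from the returned landmark to `ψ`. -/
inductive AddAll (ψ : Formula α) : List (Formula α) → LandmarkGraph α → List (Formula α) →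
    LandmarkGraph α → List (Formula α) → Prop
  | nil {G q} : AddAll ψ [] G q G q
  | cons {φ Φ G q G₁ q₁ η G₂ q₂} : AddLM φ G q G₁ q₁ η →
      AddAll ψ Φ (G₁.addOrderings {(η, OrderKind.greedyNecessary, ψ)}) q₁ G₂ q₂ →
      AddAll ψ (φ :: Φ) G q G₂ q₂

end LandmarkGraph

/-- The variables of the landmark computation: the goals of the network that have not been treated
yet, the landmark graph, and the queue of landmarks. -/
structure LMState (α : Type*) where
  queueSeeds : Finset (Node α)
  graph : LandmarkGraph α
  queue : List (Formula α)

/-- The orderings which the goal `t` (represented by the landmark `η`) shares in `gn` with goals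
that are not in `seeds` and whose landmarks are in `G`. -/
def sharedOrderings {α : Type*} (gn : GoalNetwork α) (seeds : Finset (Node α))
    (G : LandmarkGraph α) (t : Node α) (η : Formula α) :
    Set (Formula α × OrderKind × Formula α) :=
  {o | ∃ u ∈ gn.nodes, u ∉ seeds ∧ u.goal ∈ G.landmarks ∧
    ((gn.lt t u ∧ o = (η, OrderKind.natural, u.goal)) ∨
      (gn.lt u t ∧ o = (u.goal, OrderKind.natural, η)))}

/-- One iteration of the outer loop (`seed`, when the queue is empty) or of the inner loop (`pop`)
of the landmark computation for the relaxed HGN problem `(s, gn)`. The procedure `gen` is the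
landmark generation procedure for classical planning. -/
inductive LMStep {α : Type*} (gen : State α → Formula α → List (Formula α)) (s : State α)
    (gn : GoalNetwork α) : LMState α → LMState α → Prop
  | seed {seeds : Finset (Node α)} {G : LandmarkGraph α} {t : Node α} {G' q' η} : t ∈ seeds →
      (∀ u ∈ seeds, ¬ gn.lt t u) → LandmarkGraph.AddLM t.goal G [] G' q' η →
      LMStep gen s gn ⟨seeds, G, []⟩
        ⟨open scoped Classical in seeds.erase t,
          G'.addOrderings (sharedOrderings gn seeds G' t η), q' ++ [t.goal]⟩
  | pop {seeds : Finset (Node α)} {G : LandmarkGraph α} {ψ q G' q'} :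
      LandmarkGraph.AddAll ψ (gen s ψ) G q G' q' →
      LMStep gen s gn ⟨seeds, G, ψ :: q⟩ ⟨seeds, G', q'⟩

/-- `G` is a possible result of `computeHGNLandmarks(s, gn)`: a run of the procedure (with arbitrary
choices where it leaves a choice) ends with the landmark graph `G`. -/
def ComputeHGNLandmarks {α : Type*} (gen : State α → Formula α → List (Formula α)) (s : State α)
    (gn : GoalNetwork α) (G : LandmarkGraph α) : Prop :=
  Relation.ReflTransGen (LMStep gen s gn) ⟨gn.nodes, LandmarkGraph.empty, []⟩ ⟨∅, G, []⟩

/-! ### The landmark heuristic of classical planning -/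

namespace ClassicalDomain

variable {α A : Type*} (D : ClassicalDomain α A)

/-- Landmarks of `G` that were true at some point along `π`, executed from `s₀`. -/
def Accepted (G : LandmarkGraph α) (s₀ : State α) (π : List A) (φ : Formula α) : Prop :=
  φ ∈ G.landmarks ∧ D.TrueAlong s₀ π φ

/-- Accepted landmarks that are required again: false in `s = γ(s₀, π)`, and greedy-necessarily
ordered before a landmark that is not accepted. -/
def ReqAgain (G : LandmarkGraph α) (s₀ s : State α) (π : List A) (φ : Formula α) : Prop :=
  D.Accepted G s₀ π φ ∧ ¬ φ.Holds s ∧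
    ∃ φ' ∈ G.landmarks, ¬ D.Accepted G s₀ π φ' ∧ (φ, OrderKind.greedyNecessary, φ') ∈ G.orderings

/-- `Unreached = L \ (Accepted \ ReqAgain)`. -/
noncomputable def unreached (G : LandmarkGraph α) (s₀ s : State α) (π : List A) :
    Finset (Formula α) :=
  open scoped Classical in
  G.landmarks.filter fun φ => ¬ (D.Accepted G s₀ π φ ∧ ¬ D.ReqAgain G s₀ s π φ)

/-- `a` is a possible achiever of `φ` from `s` on: in some executable continuation from `s`, the
action `a` makes `φ` change from false to true. -/
def IsAchiever (s : State α) (φ : Formula α) (a : A) : Prop :=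
  ∃ ρ : List A, D.Executable s (ρ ++ [a]) ∧ ¬ φ.Holds (D.run s ρ) ∧ φ.Holds (D.run s (ρ ++ [a]))

/-- The constraints on a partition of the action costs over a finite set `U` of (unreached)
landmarks: `portion a φ` is the portion of the cost of `a` that is assigned to `φ`, and
`lmCost φ` is the cost assigned to `φ`. -/
structure IsCostPartition (s : State α) (U : Finset (Formula α)) (lmCost : Formula α → ℝ)
    (portion : A → Formula α → ℝ) : Prop where
  nonneg : ∀ φ ∈ U, ∀ a, D.IsAchiever s φ a → 0 ≤ portion a φ
  sum_le : ∀ a, (open scoped Classical in ∑ φ ∈ U.filter (fun φ => D.IsAchiever s φ a), portion a φ)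
    ≤ D.cost a
  le_portion : ∀ φ ∈ U, ∀ a, D.IsAchiever s φ a → lmCost φ ≤ portion a φ

/-- `h_L(L, s, π)`, for given costs of the landmarks. -/
noncomputable def hL (G : LandmarkGraph α) (s₀ s : State α) (π : List A)
    (lmCost : Formula α → ℝ) : ℝ :=
  ∑ φ ∈ D.unreached G s₀ s π, lmCost φ

end ClassicalDomain

/-! ### Search nodes, the HGN heuristic and the search algorithm -/

/-- A search node `(s, gn, π)`. -/
structure SearchNode (α A : Type*) where
  state : State α
  network : GoalNetwork α
  plan : List A

namespace HGNDomain

variable {α A M : Type*} (D : HGNDomain α A M)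

/-- `h` is a value of `h_HL(s, gn, π) = h_L(computeHGNLandmarks(s, gn), s, π)`, where `π` is executed
from `s₀`, for some cost partition that satisfies the constraints. -/
def IsHHL (gen : State α → Formula α → List (Formula α)) (s₀ : State α) (n : SearchNode α A)
    (h : ℝ) : Prop :=
  ∃ (G : LandmarkGraph α) (lmCost : Formula α → ℝ) (portion : A → Formula α → ℝ),
    ComputeHGNLandmarks gen n.state n.network G ∧
    D.classical.IsCostPartition n.state (D.classical.unreached G s₀ n.state n.plan) lmCost portion ∧
    h = D.classical.hL G s₀ n.state n.plan lmCost

/-- `D.Successor n n'`: the search node `n'` is one of the successors `getSuccessors(D, n)`. -/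
inductive Successor : SearchNode α A → SearchNode α A → Prop
  | goalSatisfaction {s gn π t} : gn.Unconstrained t → t.goal.Holds s →
      Successor ⟨s, gn, π⟩ ⟨s, gn.release t, π⟩
  | action {s gn π t a} : gn.Unconstrained t → D.classical.Applicable s a →
      D.classical.Relevant a t.goal →
      Successor ⟨s, gn, π⟩ ⟨D.classical.result s a, gn, π ++ [a]⟩
  | decomposition {s gn π t} (m : M) (ht : gn.Unconstrained t) : (D.method m).Applicable s →
      (D.method m).Relevant t.goal →
      Successor ⟨s, gn, π⟩ ⟨s, gn.apply t ht.1 (D.method m), π⟩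

/-- The search node `n` can be generated from the initial node `(s₀, gn₀, ⟨⟩)`. -/
def Reachable (s₀ : State α) (gn₀ : GoalNetwork α) (n : SearchNode α A) : Prop :=
  Relation.ReflTransGen D.Successor ⟨s₀, gn₀, []⟩ n

/-- The data of the search: the queue of nodes to be expanded, and the search space, which holds the
best known plan for each pair (state, goal network) that has been seen. -/
structure SearchState (α A : Type*) where
  openNodes : Multiset (SearchNode α A)
  searchSpace : State α × GoalNetwork α → Option (List A)

/-- Treatment of a generated node: if it is new or cheaper than the known plan, then it is put into
the search space and into the queue, otherwise it is skipped. -/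
noncomputable def processNode (c : SearchState α A) (n : SearchNode α A) : SearchState α A :=
  open scoped Classical in
  match c.searchSpace (n.state, n.network) with
  | some η =>
    if D.classical.planCost n.plan < D.classical.planCost η then
      ⟨n ::ₘ c.openNodes, Function.update c.searchSpace (n.state, n.network) (some n.plan)⟩
    else c
  | none =>
    ⟨n ::ₘ c.openNodes, Function.update c.searchSpace (n.state, n.network) (some n.plan)⟩

/-- The initial data: only the node `(s₀, gn₀, ⟨⟩)`. -/
noncomputable def initialSearch (s₀ : State α) (gn₀ : GoalNetwork α) : SearchState α A :=
  open scoped Classical in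
  ⟨{⟨s₀, gn₀, []⟩}, Function.update (fun _ => none) (s₀, gn₀) (some [])⟩

/-- `n` is in the queue and has the lowest value `f(n) = cost(π) + h(n)`. -/
def IsBest (h : SearchNode α A → ℝ) (c : SearchState α A) (n : SearchNode α A) : Prop :=
  n ∈ c.openNodes ∧ ∀ n' ∈ c.openNodes,
    D.classical.planCost n.plan + h n ≤ D.classical.planCost n'.plan + h n'

/-- One iteration of the search that does not return: a best node is taken from the queue, its goal
network is not empty, and its successors (listed in any order) are treated one after the other. -/
inductive SearchStep (h : SearchNode α A → ℝ) : SearchState α A → SearchState α A → Prop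
  | expand {c : SearchState α A} {n : SearchNode α A} {l : List (SearchNode α A)} :
      D.IsBest h c n → n.network.nodes ≠ ∅ → (∀ n', n' ∈ l ↔ D.Successor n n') →
      SearchStep h c (l.foldl D.processNode
        ⟨open scoped Classical in c.openNodes.erase n, c.searchSpace⟩)

/-- The A* search with heuristic `h` on `(D, s₀, gn₀)` can return the plan `π`. -/
def SearchReturns (h : SearchNode α A → ℝ) (s₀ : State α) (gn₀ : GoalNetwork α) (π : List A) :
    Prop :=
  ∃ c n, Relation.ReflTransGen (D.SearchStep h) (initialSearch s₀ gn₀) c ∧ D.IsBest h c n ∧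
    n.network.nodes = ∅ ∧ n.plan = π

/-- The A* search with heuristic `h` on `(D, s₀, gn₀)` can return `failure`. -/
def SearchFails (h : SearchNode α A → ℝ) (s₀ : State α) (gn₀ : GoalNetwork α) : Prop :=
  ∃ c, Relation.ReflTransGen (D.SearchStep h) (initialSearch s₀ gn₀) c ∧ c.openNodes = 0

end HGNDomain

end HGN

/-! Admissibility. A node leaves a goal network only by being released, in a state where its goal
holds, so every solution `ρ` makes every goal of the network true at some point. Cutting `ρ` where
`ψ` holds shows that a landmark of `ψ` is also true along `ρ`. Hence "true along `ρ`" holds for the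
goals and is preserved by the generator, and therefore holds for every computed landmark, whatever
is removed or merged on the way (`Solves.trueAlong_landmark`). The orderings affect only which
landmarks count as unreached, and all that matters there is that an unreached landmark is false in
the current state. So each of them is achieved by the action at some position of `ρ`. Charging its
cost to that position and summing position by position bounds the heuristic by the cost of `ρ`
(`IsCostPartition.sum_le_planCost`).

Optimality. The search maintains that each stored pair either waits in the queue with its stored
plan, or has a nonempty network and all its successors are covered by stored plans that cost no more
(`SearchInvariant`). Following a solution `ρ` of the initial problem through covered pairs, one must
meet a queued node `m` that has a solution `σ` with `cost(m.plan) + cost(σ) ≤ cost(ρ)`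
(`SearchInvariant.exists_open`). By admissibility `f(m) ≤ cost(ρ)`. A returned node has an empty
network, hence heuristic value 0 and an `f`-value equal to the cost of its plan, which is minimal in
the queue. An empty queue contradicts the existence of `m`. Consistency of the heuristic is not
needed, because cheaper plans reopen a pair. -/

namespace HGN

/-! ### Plans, achievers and cost partitions -/

namespace ClassicalDomain

variable {α A : Type*} {D : ClassicalDomain α A}

theorem run_append (s : State α) (π ρ : List A) :
    D.run s (π ++ ρ) = D.run (D.run s π) ρ := List.foldl_append

theorem executable_append {s : State α} {π ρ : List A} :
    D.Executable s (π ++ ρ) ↔ D.Executable s π ∧ D.Executable (D.run s π) ρ := by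
  induction π generalizing s with
  | nil => simp [Executable, run]
  | cons a π ih =>
    change D.Applicable s a ∧ D.Executable (D.result s a) (π ++ ρ) ↔
      (D.Applicable s a ∧ D.Executable (D.result s a) π) ∧
        D.Executable (D.run (D.result s a) π) ρ
    rw [ih, and_assoc]

theorem planCost_cons (a : A) (π : List A) : D.planCost (a :: π) = D.cost a + D.planCost π := by
  simp [planCost]

theorem planCost_append (π ρ : List A) :
    D.planCost (π ++ ρ) = D.planCost π + D.planCost ρ := by
  simp [planCost]

theorem planCost_nil : D.planCost [] = 0 := by
  simp [planCost]

theorem TrueAlong.of_holds {s : State α} {π : List A} {φ : Formula α} (h : φ.Holds s) :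
    D.TrueAlong s π φ := ⟨[], List.nil_prefix, h⟩

theorem TrueAlong.of_end {s : State α} {π : List A} {φ : Formula α} (h : φ.Holds (D.run s π)) :
    D.TrueAlong s π φ := ⟨π, List.prefix_rfl, h⟩

theorem TrueAlong.cons {s : State α} {a : A} {π : List A} {φ : Formula α}
    (h : D.TrueAlong (D.result s a) π φ) : D.TrueAlong s (a :: π) φ := by
  obtain ⟨ρ, hρ, h⟩ := h
  exact ⟨a :: ρ, List.cons_prefix_cons.2 ⟨rfl, hρ⟩, h⟩

theorem TrueAlong.of_prefix {s : State α} {π ρ : List A} {φ : Formula α} (hp : ρ <+: π)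
    (h : D.TrueAlong s ρ φ) : D.TrueAlong s π φ := by
  obtain ⟨σ, hσ, h⟩ := h
  exact ⟨σ, hσ.trans hp, h⟩

/-- A landmark of a formula that is true along `ρ` is true along `ρ`. -/
theorem IsLandmark.trueAlong {s : State α} {ρ : List A} {ψ φ : Formula α}
    (h : D.IsLandmark s ψ φ) (hρ : D.Executable s ρ) (hψ : D.TrueAlong s ρ ψ) :
    D.TrueAlong s ρ φ := by
  -- The prefix `σ` that ends where `ψ` holds is itself a plan for `ψ`, so the landmark property
  -- applies to it.
  obtain ⟨σ, ⟨τ, rfl⟩, hσ⟩ := hψ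
  exact (h σ (executable_append.1 hρ).1 hσ).of_prefix (List.prefix_append _ _)

/-- A formula that is false in `s` and true along an executable plan has an achiever in it. -/
theorem TrueAlong.exists_achiever {s : State α} {ρ : List A} {φ : Formula α}
    (h : D.TrueAlong s ρ φ) (hρ : D.Executable s ρ) (hs : ¬ φ.Holds s) :
    ∃ i : Fin ρ.length, D.IsAchiever s φ (ρ.get i) := by
  induction ρ using List.reverseRecOn with
  | nil =>
    obtain ⟨σ, hσ, h⟩ := h
    rw [List.prefix_nil] at hσ
    subst hσ
    exact absurd h hs
  | append_singleton ρ a ih =>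
    -- If `φ` was never true before the last action, it turns from false to true exactly there.
    by_cases hprev : D.TrueAlong s ρ φ
    · obtain ⟨i, hi⟩ := ih hprev (executable_append.1 hρ).1
      refine ⟨i.castLE (by simp), ?_⟩
      have : (ρ ++ [a])[(i : ℕ)]'(by simp) = ρ[(i : ℕ)] :=
        List.getElem_append_left i.2
      simpa [this] using hi
    · refine ⟨⟨ρ.length, by simp⟩, ?_⟩
      obtain ⟨σ, hσ, h⟩ := h
      rcases List.prefix_concat_iff.1 hσ with rfl | hσ
      · have hlast : (ρ ++ [a]).get ⟨ρ.length, by simp⟩ = a := by simp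
        rw [hlast]
        exact ⟨ρ, hρ, fun h' => hprev (.of_end h'), h⟩
      · exact absurd ⟨σ, hσ, h⟩ hprev

theorem planCost_eq_sum (ρ : List A) : D.planCost ρ = ∑ i : Fin ρ.length, D.cost (ρ.get i) := by
  simp [planCost, ← List.sum_ofFn, List.ofFn_getElem_eq_map]

/-- If every formula in `U` has an achiever in `ρ`, a cost partition over `U` does not exceed the
cost of `ρ`. -/
theorem IsCostPartition.sum_le_planCost {s : State α} {U : Finset (Formula α)}
    {lmCost : Formula α → ℝ} {portion : A → Formula α → ℝ}
    (h : D.IsCostPartition s U lmCost portion) {ρ : List A}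
    (hU : ∀ φ ∈ U, ∃ i : Fin ρ.length, D.IsAchiever s φ (ρ.get i)) :
    ∑ φ ∈ U, lmCost φ ≤ D.planCost ρ := by
  classical
  -- One position of `ρ` is chosen for each landmark. Several landmarks may share a position, and an
  -- action that occurs repeatedly pays once per occurrence.
  choose f hf using fun φ : U => hU φ φ.2
  calc ∑ φ ∈ U, lmCost φ = ∑ φ : U, lmCost φ := (Finset.sum_coe_sort U lmCost).symm
    _ ≤ ∑ φ : U, portion (ρ.get (f φ)) φ :=
      Finset.sum_le_sum fun φ _ => h.le_portion φ φ.2 _ (hf φ)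
    _ ≤ ∑ φ : U, ∑ i : Fin ρ.length,
          if D.IsAchiever s φ (ρ.get i) then portion (ρ.get i) φ else 0 := by
      refine Finset.sum_le_sum fun φ _ => ?_
      -- The chosen position is one summand, and the others are nonnegative because only achievers
      -- contribute.
      refine le_trans (if_pos (hf φ)).ge <| Finset.single_le_sum
        (f := fun i => if D.IsAchiever s φ (ρ.get i) then portion (ρ.get i) φ else 0)
        (fun i _ => ?_) (Finset.mem_univ (f φ))
      split_ifs with ha
      · exact h.nonneg φ φ.2 _ ha
      · exact le_rfl
    _ = ∑ i : Fin ρ.length, ∑ φ : U,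
          if D.IsAchiever s φ (ρ.get i) then portion (ρ.get i) φ else 0 := Finset.sum_comm
    _ ≤ ∑ i : Fin ρ.length, D.cost (ρ.get i) := by
      refine Finset.sum_le_sum fun i _ => ?_
      rw [Finset.sum_coe_sort U
        (fun φ => if D.IsAchiever s φ (ρ.get i) then portion (ρ.get i) φ else 0),
        ← Finset.sum_filter]
      convert h.sum_le (ρ.get i)
    _ = D.planCost ρ := (planCost_eq_sum ρ).symm

/-- The end of `π` counts as a point along `π`, so a landmark true there is accepted. It is not
required again, since that demands that it be false. -/
theorem not_holds_of_mem_unreached {G : LandmarkGraph α} {s₀ : State α} {π : List A}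
    {φ : Formula α} (h : φ ∈ D.unreached G s₀ (D.run s₀ π) π) : ¬ φ.Holds (D.run s₀ π) := by
  classical
  intro hs
  obtain ⟨hG, hφ⟩ := Finset.mem_filter.1 h
  exact hφ ⟨⟨hG, .of_end hs⟩, fun hr => hr.2.1 hs⟩

end ClassicalDomain

/-! ### Invariants of the landmark computation -/

namespace LandmarkGraph

variable {α : Type*} {P : Formula α → Prop}

theorem RemoveSubsumed.forall_mem {G G' : LandmarkGraph α} {φ : Formula α}
    (h : G.RemoveSubsumed φ G') (hG : ∀ φ ∈ G.landmarks, P φ) : ∀ φ ∈ G'.landmarks, P φ := by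
  classical
  obtain ⟨R, -, -, rfl⟩ := h
  intro χ hχ
  simp only [remove, Finset.mem_sdiff] at hχ
  exact hG χ hχ.1

/-- Only `φ` can enter the graph or the queue, while removal and subsumption create no new formula.
The predicate `P` stays arbitrary: it is used both with "true along `ρ`" and with `False`. -/
theorem AddLM.forall_mem {φ η : Formula α} {G G' : LandmarkGraph α} {q q' : List (Formula α)}
    (h : AddLM φ G q G' q' η) (hφ : P φ) (hG : ∀ φ ∈ G.landmarks, P φ) (hq : ∀ φ ∈ q, P φ) :
    (∀ φ ∈ G'.landmarks, P φ) ∧ ∀ φ ∈ q', P φ := by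
  classical
  cases h with
  | subsumed hr _ _ => exact ⟨hr.forall_mem hG, hq⟩
  | new hr _ =>
    constructor
    · intro χ hχ
      simp only [insert, Finset.mem_insert] at hχ
      rcases hχ with rfl | hχ
      · exact hφ
      · exact hr.forall_mem hG χ hχ
    · intro χ hχ
      rcases List.mem_append.1 hχ with hχ | hχ
      · exact hq χ hχ
      · rwa [List.mem_singleton.1 hχ]

theorem AddAll.forall_mem {ψ : Formula α} {Φ : List (Formula α)} {G G' : LandmarkGraph α}
    {q q' : List (Formula α)} (h : AddAll ψ Φ G q G' q') (hΦ : ∀ φ ∈ Φ, P φ)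
    (hG : ∀ φ ∈ G.landmarks, P φ) (hq : ∀ φ ∈ q, P φ) :
    (∀ φ ∈ G'.landmarks, P φ) ∧ ∀ φ ∈ q', P φ := by
  induction h with
  | nil => exact ⟨hG, hq⟩
  | cons hadd _ ih =>
    obtain ⟨h1, h2⟩ := hadd.forall_mem (hΦ _ List.mem_cons_self) hG hq
    exact ih (fun χ hχ => hΦ χ (List.mem_cons_of_mem _ hχ)) h1 h2

end LandmarkGraph

section LandmarkComputation

variable {α : Type*} {P : Formula α → Prop} {gen : State α → Formula α → List (Formula α)}
  {s : State α} {gn : GoalNetwork α}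

/-- All formulas that occur in a state of the landmark computation satisfy `P`, and all goals that
remain to be treated belong to `gn`. -/
structure LMState.Forall (P : Formula α → Prop) (gn : GoalNetwork α) (c : LMState α) : Prop where
  seeds : c.queueSeeds ⊆ gn.nodes
  graph : ∀ φ ∈ c.graph.landmarks, P φ
  queue : ∀ φ ∈ c.queue, P φ

theorem LMStep.forall {c c' : LMState α} (h : LMStep gen s gn c c')
    (hgoal : ∀ t ∈ gn.nodes, P t.goal) (hgen : ∀ ψ, P ψ → ∀ φ ∈ gen s ψ, P φ)
    (hc : c.Forall P gn) : c'.Forall P gn := by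
  classical
  cases h with
  | seed ht _ hadd =>
    have hgt := hgoal _ (hc.seeds ht)
    obtain ⟨h1, h2⟩ := hadd.forall_mem hgt hc.graph hc.queue
    refine ⟨fun u hu => hc.seeds (Finset.mem_of_mem_erase hu), h1, fun χ hχ => ?_⟩
    -- The goal is queued here in any case, even if `AddLM` has replaced it by a stronger landmark
    -- or has already queued it.
    rcases List.mem_append.1 hχ with hχ | hχ
    · exact h2 χ hχ
    · rwa [List.mem_singleton.1 hχ]
  | pop hadd =>
    obtain ⟨h1, h2⟩ := hadd.forall_mem (hgen _ (hc.queue _ List.mem_cons_self)) hc.graph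
      fun χ hχ => hc.queue χ (List.mem_cons_of_mem _ hχ)
    exact ⟨hc.seeds, h1, h2⟩

/-- Every computed landmark has each property that the goals of the network have and that the
generator preserves. -/
theorem ComputeHGNLandmarks.forall_mem {G : LandmarkGraph α} (h : ComputeHGNLandmarks gen s gn G)
    (hgoal : ∀ t ∈ gn.nodes, P t.goal) (hgen : ∀ ψ, P ψ → ∀ φ ∈ gen s ψ, P φ) :
    ∀ φ ∈ G.landmarks, P φ := by
  have key : ∀ c, Relation.ReflTransGen (LMStep gen s gn) ⟨gn.nodes, .empty, []⟩ c →
      c.Forall P gn := by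
    intro c hc
    induction hc with
    | refl => exact ⟨subset_rfl, by simp [LandmarkGraph.empty], by simp⟩
    | tail _ hstep ih => exact hstep.forall hgoal hgen ih
  exact (key _ h).graph

theorem ComputeHGNLandmarks.landmarks_eq_empty {G : LandmarkGraph α}
    (h : ComputeHGNLandmarks gen s gn G) (hgn : gn.nodes = ∅) : G.landmarks = ∅ := by
  refine Finset.eq_empty_of_forall_notMem fun φ hφ => ?_
  -- Without goals nothing is ever queued, so even the predicate `False` is an invariant.
  exact h.forall_mem (P := fun _ => False) (by simp [hgn]) (fun _ h => h.elim) φ hφ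

end LandmarkComputation

/-! ### Solutions, admissibility and search nodes -/

namespace HGNDomain

variable {α A M : Type*} {D : HGNDomain α A M}

theorem Solves.executable {s : State α} {gn : GoalNetwork α} {ρ : List A} (h : D.Solves s gn ρ) :
    D.classical.Executable s ρ := by
  induction h with
  | base _ => trivial
  | goalSatisfaction _ _ _ ih => exact ih
  | action _ ha _ _ ih => exact ⟨ha, ih⟩
  | decomposition _ _ _ _ _ ih => exact ih

/-- Every goal of the network is true at some point along every solution. -/
theorem Solves.trueAlong_goal {s : State α} {gn : GoalNetwork α} {ρ : List A}
    (h : D.Solves s gn ρ) {t : Node α} (ht : t ∈ gn.nodes) :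
    D.classical.TrueAlong s ρ t.goal := by
  classical
  induction h with
  | base h => simp [h] at ht
  | @goalSatisfaction s gn u π _ hg _ ih =>
    -- Either `t` is released now, so its goal holds in the present state, or it survives in the
    -- smaller network.
    by_cases htu : t = u
    · subst htu
      exact .of_holds hg
    · refine ih ?_
      simp only [GoalNetwork.release, Finset.mem_erase]
      exact ⟨htu, ht⟩
  | action _ _ _ _ ih => exact (ih ht).cons
  | decomposition m hu _ _ _ ih =>
    refine ih ?_
    simp only [GoalNetwork.apply, Finset.mem_union]
    exact .inl ht

theorem Solves.trueAlong_landmark {gen : State α → Formula α → List (Formula α)}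
    (hgen : D.classical.SoundGenerator gen) {s : State α} {gn : GoalNetwork α} {ρ : List A}
    (h : D.Solves s gn ρ) {G : LandmarkGraph α} (hG : ComputeHGNLandmarks gen s gn G) :
    ∀ φ ∈ G.landmarks, D.classical.TrueAlong s ρ φ :=
  hG.forall_mem (fun _ ht => h.trueAlong_goal ht) fun ψ hψ φ hφ =>
    (hgen s ψ φ hφ).trueAlong h.executable hψ

/-- Admissibility of the landmark heuristic. -/
theorem IsHHL.le_planCost {gen : State α → Formula α → List (Formula α)}
    (hgen : D.classical.SoundGenerator gen) {s₀ : State α} {n : SearchNode α A}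
    (hrun : D.classical.run s₀ n.plan = n.state) {h : ℝ} (hh : D.IsHHL gen s₀ n h) {ρ : List A}
    (hρ : D.Solves n.state n.network ρ) : h ≤ D.classical.planCost ρ := by
  classical
  obtain ⟨G, lmCost, portion, hG, hpart, rfl⟩ := hh
  refine hpart.sum_le_planCost fun φ hφ => ?_
  have hmem : φ ∈ G.landmarks := (Finset.mem_filter.1 hφ).1
  refine (hρ.trueAlong_landmark hgen hG φ hmem).exists_achiever hρ.executable ?_
  rw [← hrun] at hφ ⊢
  exact ClassicalDomain.not_holds_of_mem_unreached hφ

theorem IsHHL.eq_zero {gen : State α → Formula α → List (Formula α)} {s₀ : State α}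
    {n : SearchNode α A} {h : ℝ} (hh : D.IsHHL gen s₀ n h) (hn : n.network.nodes = ∅) :
    h = 0 := by
  obtain ⟨G, lmCost, portion, hG, -, rfl⟩ := hh
  simp [ClassicalDomain.hL, ClassicalDomain.unreached, hG.landmarks_eq_empty hn]

theorem Reachable.run_eq {s₀ : State α} {gn₀ : GoalNetwork α} {n : SearchNode α A}
    (h : D.Reachable s₀ gn₀ n) : D.classical.run s₀ n.plan = n.state := by
  induction h with
  | refl => rfl
  | tail _ hs ih =>
    cases hs with
    | goalSatisfaction _ _ => exact ih
    | action _ _ _ => rw [ClassicalDomain.run_append, ih]; rfl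
    | decomposition _ _ _ _ => exact ih

/-- Each kind of successor is a rule of `Solves` read backwards. An action moves from the end of the
plan to the head of the remaining solution. -/
theorem Reachable.solves_append {s₀ : State α} {gn₀ : GoalNetwork α} {n : SearchNode α A}
    (h : D.Reachable s₀ gn₀ n) {ρ : List A} (hρ : D.Solves n.state n.network ρ) :
    D.Solves s₀ gn₀ (n.plan ++ ρ) := by
  induction h generalizing ρ with
  | refl => exact hρ
  | tail _ hs ih =>
    cases hs with
    | goalSatisfaction hu hg => exact ih (.goalSatisfaction hu hg hρ)
    | action hu ha hr => simpa using ih (.action hu ha hr hρ)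
    | decomposition m hu ha hr => exact ih (.decomposition m hu ha hr hρ)

/-! ### The invariant of the search -/

/-- The key of `n` is in the search space, with a plan that is at most as expensive as `n.plan`. -/
def SearchState.Covers (D : HGNDomain α A M) (c : SearchState α A) (n : SearchNode α A) : Prop :=
  ∃ η, c.searchSpace (n.state, n.network) = some η ∧
    D.classical.planCost η ≤ D.classical.planCost n.plan

/-- The relation between the data before and after the treatment of some generated nodes: every
entry of the search space is an old one or is waiting in the queue. -/
structure SearchState.Extends (D : HGNDomain α A M) (c c' : SearchState α A) : Prop where
  openNodes_le : c.openNodes ≤ c'.openNodes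
  covers : ∀ n, c.Covers D n → c'.Covers D n
  entry : ∀ s gn η, c'.searchSpace (s, gn) = some η →
    c.searchSpace (s, gn) = some η ∨ ⟨s, gn, η⟩ ∈ c'.openNodes

theorem SearchState.Extends.refl (c : SearchState α A) : c.Extends D c :=
  ⟨le_rfl, fun _ h => h, fun _ _ _ h => .inl h⟩

theorem SearchState.Extends.trans {c₁ c₂ c₃ : SearchState α A} (h : c₁.Extends D c₂)
    (h' : c₂.Extends D c₃) : c₁.Extends D c₃ where
  openNodes_le := h.openNodes_le.trans h'.openNodes_le
  covers n hn := h'.covers n (h.covers n hn)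
  entry s gn η hη := by
    rcases h'.entry s gn η hη with h2 | h2
    · exact (h.entry s gn η h2).imp_right fun h3 => Multiset.mem_of_le h'.openNodes_le h3
    · exact .inr h2

/-- The hypothesis `hc` says that overwriting never replaces a plan by a more expensive one, so
covered nodes stay covered. The only changed entry is that of the pushed node, which is in the
queue. -/
theorem extends_push (c : SearchState α A) (n : SearchNode α A)
    (hc : ∀ η, c.searchSpace (n.state, n.network) = some η →
      D.classical.planCost n.plan ≤ D.classical.planCost η) :
    c.Extends D ⟨n ::ₘ c.openNodes, open scoped Classical in
      Function.update c.searchSpace (n.state, n.network) (some n.plan)⟩ where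
  openNodes_le := Multiset.le_cons_self _ _
  covers m := by
    classical
    rintro ⟨η, hη, hle⟩
    by_cases hk : (m.state, m.network) = (n.state, n.network)
    · refine ⟨n.plan, by simp [hk], ?_⟩
      rw [hk] at hη
      exact (hc η hη).trans hle
    · exact ⟨η, by simp only [Function.update_of_ne hk, hη], hle⟩
  entry s gn η hη := by
    classical
    by_cases hk : (s, gn) = (n.state, n.network)
    · right
      obtain ⟨rfl, rfl⟩ := Prod.mk.inj hk
      simp only [Function.update_self, Option.some.injEq] at hη
      subst hη
      exact Multiset.mem_cons_self _ _
    · left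
      simpa only [Function.update_of_ne hk] using hη

theorem covers_push (c : SearchState α A) (n : SearchNode α A) :
    SearchState.Covers D ⟨n ::ₘ c.openNodes, open scoped Classical in
      Function.update c.searchSpace (n.state, n.network) (some n.plan)⟩ n :=
  ⟨n.plan, by simp, le_rfl⟩

theorem processNode_spec (c : SearchState α A) (n : SearchNode α A) :
    c.Extends D (D.processNode c n) ∧ (D.processNode c n).Covers D n ∧
      ∀ m ∈ (D.processNode c n).openNodes, m ∈ c.openNodes ∨ m = n := by
  classical
  unfold processNode
  split
  · rename_i η hη
    split_ifs with hlt
    · refine ⟨extends_push c n fun η' h' => ?_, covers_push c n, fun m hm => ?_⟩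
      · rw [hη, Option.some.injEq] at h'
        exact h' ▸ hlt.le
      · exact (Multiset.mem_cons.1 hm).symm
    -- A skipped node is covered by the known plan that made it superfluous.
    · exact ⟨.refl c, ⟨η, hη, not_lt.1 hlt⟩, fun m hm => .inl hm⟩
  · rename_i hnone
    refine ⟨extends_push c n fun η' h' => ?_, covers_push c n, fun m hm => ?_⟩
    · simp [hnone] at h'
    · exact (Multiset.mem_cons.1 hm).symm

theorem foldl_processNode_spec (l : List (SearchNode α A)) (c : SearchState α A) :
    c.Extends D (l.foldl D.processNode c) ∧ (∀ n ∈ l, (l.foldl D.processNode c).Covers D n) ∧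
      ∀ m ∈ (l.foldl D.processNode c).openNodes, m ∈ c.openNodes ∨ m ∈ l := by
  induction l generalizing c with
  | nil => exact ⟨.refl c, by simp, fun m hm => .inl hm⟩
  | cons n l ih =>
    obtain ⟨h1, h2, h3⟩ := processNode_spec (D := D) c n
    obtain ⟨i1, i2, i3⟩ := ih (D.processNode c n)
    refine ⟨h1.trans i1, fun m hm => ?_, fun m hm => ?_⟩
    · rcases List.mem_cons.1 hm with rfl | hm
      · exact i1.covers _ h2
      · exact i2 m hm
    · rcases i3 m hm with hm | hm
      · rcases h3 m hm with hm | rfl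
        · exact .inl hm
        · exact .inr List.mem_cons_self
      · exact .inr (List.mem_cons_of_mem _ hm)

/-- The invariant of the search: every entry of the search space is in the queue or has been
expanded. -/
structure SearchInvariant (D : HGNDomain α A M) (s₀ : State α) (gn₀ : GoalNetwork α)
    (c : SearchState α A) : Prop where
  reachable : ∀ n ∈ c.openNodes, D.Reachable s₀ gn₀ n
  covers_initial : c.Covers D ⟨s₀, gn₀, []⟩
  entry : ∀ s gn η, c.searchSpace (s, gn) = some η → ⟨s, gn, η⟩ ∈ c.openNodes ∨
    (gn.nodes ≠ ∅ ∧ ∀ n', D.Successor ⟨s, gn, η⟩ n' → c.Covers D n')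

theorem searchInvariant_initial (s₀ : State α) (gn₀ : GoalNetwork α) :
    D.SearchInvariant s₀ gn₀ (initialSearch s₀ gn₀) where
  reachable n hn := by
    rw [Multiset.mem_singleton.1 hn]
    exact .refl
  covers_initial := ⟨[], by simp [initialSearch], le_rfl⟩
  entry s gn η hη := by
    classical
    left
    by_cases hk : (s, gn) = (s₀, gn₀)
    · obtain ⟨rfl, rfl⟩ := Prod.mk.inj hk
      simp only [initialSearch, Function.update_self, Option.some.injEq] at hη
      subst hη
      exact Multiset.mem_singleton_self _
    · simp [initialSearch, Function.update_of_ne hk] at hη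

theorem SearchInvariant.step {h : SearchNode α A → ℝ} {s₀ : State α} {gn₀ : GoalNetwork α}
    {c c' : SearchState α A} (hc : D.SearchInvariant s₀ gn₀ c) (hs : D.SearchStep h c c') :
    D.SearchInvariant s₀ gn₀ c' := by
  classical
  cases hs with
  | @expand n l hbest hne hl =>
    obtain ⟨hext, hcov, hmem⟩ := foldl_processNode_spec (D := D) l
      ⟨open scoped Classical in c.openNodes.erase n, c.searchSpace⟩
    refine ⟨fun m hm => ?_, hext.covers _ hc.covers_initial, fun s gn η hη => ?_⟩
    · rcases hmem m hm with hm | hm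
      · exact hc.reachable m (Multiset.mem_of_mem_erase hm)
      · exact (hc.reachable n hbest.1).tail ((hl m).1 hm)
    · rcases hext.entry s gn η hη with hη | hη
      · rcases hc.entry s gn η hη with ho | ⟨hgn, hsucc⟩
        -- If the stored node is the one just taken out, it now counts as expanded. Otherwise, for
        -- instance when `n` carries an outdated plan for the same pair, the stored node remains
        -- queued.
        · by_cases hn : (⟨s, gn, η⟩ : SearchNode α A) = n
          · subst hn
            exact .inr ⟨hne, fun n' hn' => hcov n' ((hl n').2 hn')⟩
          · exact .inl (Multiset.mem_of_le hext.openNodes_le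
              ((Multiset.mem_erase_of_ne hn).2 ho))
        · exact .inr ⟨hgn, fun n' hn' => hext.covers n' (hsucc n' hn')⟩
      · exact .inl hη

theorem searchInvariant_of_reflTransGen {h : SearchNode α A → ℝ} {s₀ : State α}
    {gn₀ : GoalNetwork α} {c : SearchState α A}
    (hc : Relation.ReflTransGen (D.SearchStep h) (initialSearch s₀ gn₀) c) :
    D.SearchInvariant s₀ gn₀ c := by
  induction hc with
  | refl => exact searchInvariant_initial s₀ gn₀
  | tail _ hs ih => exact ih.step hs

/-! ### Optimality of returned plans and correctness of failure -/

/-- A solution of a covered node passes through a node in the queue. -/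
theorem SearchInvariant.exists_open {s₀ : State α} {gn₀ : GoalNetwork α} {c : SearchState α A}
    (hc : D.SearchInvariant s₀ gn₀ c) {s : State α} {gn : GoalNetwork α} {ρ : List A}
    (hρ : D.Solves s gn ρ) {π : List A} (hπ : c.Covers D ⟨s, gn, π⟩) :
    ∃ n ∈ c.openNodes, ∃ σ, D.Solves n.state n.network σ ∧
      D.classical.planCost n.plan + D.classical.planCost σ ≤
        D.classical.planCost π + D.classical.planCost ρ := by
  -- Common to all rules: if the stored node is queued, it is the required one with `σ = ρ`.
  -- Otherwise it was expanded, and the argument continues with the stored plan `η` instead of `π`,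
  -- which costs no more.
  have key : ∀ {s gn ρ π}, D.Solves s gn ρ → c.Covers D ⟨s, gn, π⟩ →
      (∀ η, gn.nodes ≠ ∅ → (∀ n', D.Successor ⟨s, gn, η⟩ n' → c.Covers D n') →
        ∃ n ∈ c.openNodes, ∃ σ, D.Solves n.state n.network σ ∧
          D.classical.planCost n.plan + D.classical.planCost σ ≤
            D.classical.planCost η + D.classical.planCost ρ) →
      ∃ n ∈ c.openNodes, ∃ σ, D.Solves n.state n.network σ ∧
        D.classical.planCost n.plan + D.classical.planCost σ ≤
          D.classical.planCost π + D.classical.planCost ρ := by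
    rintro s gn ρ π hρ ⟨η, hη, hle⟩ hexp
    rcases hc.entry s gn η hη with ho | ⟨hne, hsucc⟩
    · exact ⟨_, ho, ρ, hρ, add_le_add_left hle _⟩
    · obtain ⟨n, hn, σ, hσ, hcost⟩ := hexp η hne hsucc
      exact ⟨n, hn, σ, hσ, hcost.trans (add_le_add_left hle _)⟩
  induction hρ generalizing π with
  -- Nodes with an empty network are never expanded, so the stored node must be in the queue.
  | base hgn => exact key (.base hgn) hπ fun _ hne _ => absurd hgn hne
  | goalSatisfaction hu hg hsol ih =>
    exact key (.goalSatisfaction hu hg hsol) hπ fun η _ hsucc =>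
      ih (hsucc _ (.goalSatisfaction hu hg))
  | @action s gn t a ρ hu ha hr hsol ih =>
    refine key (.action hu ha hr hsol) hπ fun η _ hsucc => ?_
    obtain ⟨n, hn, σ, hσ, hcost⟩ := ih (hsucc _ (.action hu ha hr))
    refine ⟨n, hn, σ, hσ, hcost.trans_eq ?_⟩
    -- The cost of `a` passes from the solution to the plan, so the total is unchanged.
    rw [ClassicalDomain.planCost_append, ClassicalDomain.planCost_cons,
      ClassicalDomain.planCost_cons, ClassicalDomain.planCost_nil]
    ring
  | decomposition m hu ha hr hsol ih =>
    exact key (.decomposition m hu ha hr hsol) hπ fun η _ hsucc =>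
      ih (hsucc _ (.decomposition m hu ha hr))

/-- A returned plan is a solution. -/
theorem SearchReturns.solves {h : SearchNode α A → ℝ} {s₀ : State α} {gn₀ : GoalNetwork α}
    {π : List A} (hπ : D.SearchReturns h s₀ gn₀ π) : D.Solves s₀ gn₀ π := by
  obtain ⟨c, n, hc, hbest, hn, rfl⟩ := hπ
  have hr := (searchInvariant_of_reflTransGen hc).reachable n hbest.1
  simpa using hr.solves_append (.base hn)

/-- A search with an admissible heuristic that vanishes on empty networks returns only optimal
solutions. -/
theorem SearchReturns.isHierarchicallyOptimal {h : SearchNode α A → ℝ} {s₀ : State α}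
    {gn₀ : GoalNetwork α}
    (hadm : ∀ n, D.Reachable s₀ gn₀ n → ∀ σ, D.Solves n.state n.network σ →
      h n ≤ D.classical.planCost σ)
    (hzero : ∀ n, D.Reachable s₀ gn₀ n → n.network.nodes = ∅ → h n = 0)
    {π : List A} (hπ : D.SearchReturns h s₀ gn₀ π) : D.IsHierarchicallyOptimal s₀ gn₀ π := by
  refine ⟨hπ.solves, fun ρ hρ => ?_⟩
  obtain ⟨c, n, hc, hbest, hn, rfl⟩ := hπ
  have hinv := searchInvariant_of_reflTransGen hc
  obtain ⟨m, hm, σ, hσ, hcost⟩ := hinv.exists_open hρ hinv.covers_initial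
  -- The chain is `cost(n.plan) = f(n) ≤ f(m) ≤ cost(m.plan) + cost(σ) ≤ cost(ρ)`.
  have h1 := hbest.2 m hm
  have h2 := hadm m (hinv.reachable m hm) σ hσ
  rw [hzero n (hinv.reachable n hbest.1) hn] at h1
  rw [ClassicalDomain.planCost_nil] at hcost
  linarith

theorem SearchFails.not_exists_solves {h : SearchNode α A → ℝ} {s₀ : State α}
    {gn₀ : GoalNetwork α} (hf : D.SearchFails h s₀ gn₀) : ¬ ∃ ρ, D.Solves s₀ gn₀ ρ := by
  rintro ⟨ρ, hρ⟩
  obtain ⟨c, hc, hempty⟩ := hf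
  have hinv := searchInvariant_of_reflTransGen hc
  obtain ⟨m, hm, -⟩ := hinv.exists_open hρ hinv.covers_initial
  simp [hempty] at hm

end HGNDomain

end HGN

theorem theorem2 {α A M : Type*} (D : HGN.HGNDomain α A M)
    (gen : HGN.State α → HGN.Formula α → List (HGN.Formula α))
    (hgen : D.classical.SoundGenerator gen) :
    -- admissibility of the heuristic at every search node, for every admitted cost partition
    (∀ (s₀ : HGN.State α) (n : HGN.SearchNode α A),
      D.classical.Executable s₀ n.plan → D.classical.run s₀ n.plan = n.state →
      ∀ h : ℝ, D.IsHHL gen s₀ n h →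
        ∀ ρ : List A, D.Solves n.state n.network ρ → h ≤ D.classical.planCost ρ) ∧
    -- hierarchical optimality of the A* search that uses the heuristic
    (∀ (s₀ : HGN.State α) (gn₀ : HGN.GoalNetwork α) (h : HGN.SearchNode α A → ℝ),
      (∀ n, D.Reachable s₀ gn₀ n → D.IsHHL gen s₀ n (h n)) →
      (∀ π : List A, D.SearchReturns h s₀ gn₀ π → D.IsHierarchicallyOptimal s₀ gn₀ π) ∧
      (D.SearchFails h s₀ gn₀ → ¬ ∃ ρ : List A, D.Solves s₀ gn₀ ρ)) := by
  refine ⟨fun s₀ n _ hrun h hh ρ hρ => hh.le_planCost hgen hrun hρ, fun s₀ gn₀ h hh => ⟨?_, ?_⟩⟩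
  · intro π hπ
    exact hπ.isHierarchicallyOptimal
      (fun n hn σ hσ => (hh n hn).le_planCost hgen hn.run_eq hσ)
      (fun n hn he => (hh n hn).eq_zero he)
  · exact fun hf => hf.not_exists_solves
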